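/- Let $K$ be a finite unramified extension of $\mathbb{Q}_2$ with ring of integers $\mathcal{O}_K$ and maximal ideal $\mathfrak{m}_K=(2)$. Put $R=\mathcal{O}_K/\mathfrak{m}_K^2$, let $\mathrm{tr}:R\to\mathbb{Z}/4$ be the map induced by the trace $\mathcal{O}_K\to\mathbb{Z}_2$, and let $\psi:R\to\mathbb{C}^\times$, $\psi(z)=e^{\frac{2\pi i}{4}\mathrm{tr}(z)}$. Let $(\widetilde V,\widetilde\omega)$ be a free symplectic $R$-module of finite rank (that is, $\widetilde\omega$ is alternating and perfect), with a fixed splitting $\widetilde V=\widetilde L\times\widetilde M$ into Lagrangian submodules. Let $V=\widetilde V/2\widetilde V$ and let $\beta:V\times V\to R$ be the form induced by $\big((\tilde l_1,\tilde m_1),(\tilde l_2,\tilde m_2)\big)\mapsto 2\,\widetilde\omega(\tilde l_1,\tilde m_2)$. Let $H(V)=V\times R$ be the Heisenberg group with multiplication $(v_1,z_1)\cdot(v_2,z_2)=(v_1+v_2,\,z_1+z_2+\beta(v_1,v_2))$, and let $ASp(V)$ be the affine symplectic group, i.e. the group of automorphisms of $H(V)$ acting trivially on the center. A Heisenberg representation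 is an irreducible complex representation $\pi:H(V)\to GL(\mathcal{H})$ with $\pi(0,z)=\psi(z)\,\mathrm{Id}$ for all $z\in R$. **Theorem (The Weil representation).** A Heisenberg representation exists, and there is a group $AMp(V)$ which is a central extension $$1\to\mu_4\to AMp(V)\to ASp(V)\to 1$$ of $ASp(V)$ by the group $\mu_4\subset\mathbb{C}^\times$ of fourth roots of unity, such that for every Heisenberg representation $(\pi,\mathcal{H})$: 1. there is a unique homomorphism $\widetilde\rho:ASp(V)\to PGL(\mathcal{H})$ (the projective Weil representation) such that $\widetilde\rho(g)\,\pi(h)\,\widetilde\rho(g)^{-1}=\pi(g(h))$ for all $g\in ASp(V)$ and $h\in H(V)$; 2. there is a linear representation $\rho:AMp(V)\to GL(\mathcal{H})$ lying over $\widetilde\rho$, i.e. for every $a\in AMp(V)$ the image of $\rho(a)$ in $PGL(\mathcal{H})$ is $\widetilde\rho(\bar a)$, where $\bar a$ is the image of $a$ in $ASp(V)$. -/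

import Mathlib

universe u v w

namespace WeilCharTwo

noncomputable section

/-! ### The ring `R = 𝒪_K / 𝔪_K²` of an unramified extension `K` of `ℚ₂` -/

section Ring

variable (K : Type*) [Field K] [Algebra ℤ_[2] K]

/-- The ring of integers `𝒪_K`: the integral closure of `ℤ₂` in `K`. -/
abbrev IntegerRing : Type _ := integralClosure ℤ_[2] K

/-- The ideal `(2)` of `𝒪_K`; when `K` is unramified over `ℚ₂` it is the maximal ideal `𝔪_K`. -/
abbrev twoIdeal : Ideal (IntegerRing K) := Ideal.span {(2 : IntegerRing K)}

/-- `K / ℚ₂` is unramified: the prime `2` of `ℤ₂` stays a uniformizer, that is, it generates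
the maximal ideal of (the local ring) `𝒪_K`. The residue fields being finite, the residue
extension is automatically separable. -/
def IsUnramified : Prop := (twoIdeal K).IsMaximal

/-- The finite ring `R = 𝒪_K / 𝔪_K²`, with `𝔪_K = (2)`. -/
def ResidueRing : Type _ := IntegerRing K ⧸ (twoIdeal K) ^ 2

instance : CommRing (ResidueRing K) :=
  inferInstanceAs (CommRing (IntegerRing K ⧸ (twoIdeal K) ^ 2))

/-- The quotient map `𝒪_K → R`. -/
def toResidueRing : IntegerRing K →+* ResidueRing K := Ideal.Quotient.mk ((twoIdeal K) ^ 2)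

theorem toResidueRing_surjective : Function.Surjective (toResidueRing K) :=
  Ideal.Quotient.mk_surjective

theorem toResidueRing_eq_zero_iff (x : IntegerRing K) :
    toResidueRing K x = 0 ↔ x ∈ (twoIdeal K) ^ 2 :=
  Ideal.Quotient.eq_zero_iff_mem

/-- The trace of `𝒪_K` over `ℤ₂` followed by the reduction `ℤ₂ → ℤ/4`. -/
def traceModFour : IntegerRing K →+ ZMod 4 :=
  ((PadicInt.toZModPow 2 : ℤ_[2] →+* ZMod (2 ^ 2)) : ℤ_[2] →+ ZMod 4).comp
    (Algebra.trace ℤ_[2] (IntegerRing K)).toAddMonoidHom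

theorem traceModFour_eq_zero (x : IntegerRing K) (hx : x ∈ (twoIdeal K) ^ 2) :
    traceModFour K x = 0 := by
  rw [Ideal.span_singleton_pow, Ideal.mem_span_singleton] at hx
  obtain ⟨y, rfl⟩ := hx
  have h : ((2 : IntegerRing K) ^ 2 * y) = y + y + y + y := by ring
  have h4 : ∀ z : ZMod 4, z + z + z + z = 0 := by decide
  rw [h, map_add, map_add, map_add]
  exact h4 _

/-- The trace map `tr : R → ℤ/4`, induced by the trace of `𝒪_K` over `ℤ₂`. -/
def tr : ResidueRing K →+ ZMod 4 :=
  QuotientAddGroup.lift ((twoIdeal K) ^ 2).toAddSubgroup (traceModFour K)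
    (fun x hx => traceModFour_eq_zero K x hx)

theorem tr_toResidueRing (x : IntegerRing K) :
    tr K (toResidueRing K x) =
      PadicInt.toZModPow (p := 2) 2 (Algebra.trace ℤ_[2] (IntegerRing K) x) := rfl

/-- The character `ψ(z) = exp (2πi · tr(z) / 4)` of `R`. -/
def psi : AddChar (ResidueRing K) ℂ :=
  (ZMod.stdAddChar (N := 4)).compAddMonoidHom (tr K)

theorem two_mul_two : (2 : ResidueRing K) * 2 = 0 := by
  have h : toResidueRing K (2 ^ 2) = 0 :=
    (toResidueRing_eq_zero_iff K _).2 (Ideal.pow_mem_pow (Ideal.mem_span_singleton_self _) 2)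
  rwa [map_pow, map_ofNat, pow_two] at h

end Ring

/-! ### Symplectic modules and Lagrangian splittings -/

section Symplectic

variable {A W : Type*} [CommRing A] [AddCommGroup W] [Module A W]

/-- A symplectic form: alternating, and perfect (both adjoints `W → W^*` are bijective). -/
structure IsSymplectic (ω : LinearMap.BilinForm A W) : Prop where
  alt : ω.IsAlt
  perfect : ω.IsPerfPair

/-- A splitting of `W` as the direct sum of two Lagrangian submodules (submodules equal to their
own orthogonal complement). -/
structure LagrangianSplitting (ω : LinearMap.BilinForm A W) where
  /-- the first Lagrangian -/
  L : Submodule A W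
  /-- the second Lagrangian -/
  M : Submodule A W
  isCompl : IsCompl L M
  lagrangian_left : ω.orthogonal L = L
  lagrangian_right : ω.orthogonal M = M

/-- The bilinear form `((l₁, m₁), (l₂, m₂)) ↦ ω(l₁, m₂)` attached to a Lagrangian splitting. -/
def LagrangianSplitting.form {ω : LinearMap.BilinForm A W} (S : LagrangianSplitting ω) :
    LinearMap.BilinForm A W :=
  ω.compl₁₂ (S.L.subtype ∘ₗ S.L.projectionOnto S.M S.isCompl)
    (S.M.subtype ∘ₗ S.M.projectionOnto S.L S.isCompl.symm)

end Symplectic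

section Reduction

variable {A W : Type*} [CommRing A] [AddCommGroup W] [Module A W]

variable (A W) in
/-- The reduction `V = W / 2W` of an `A`-module `W`. -/
abbrev Reduction : Type _ := W ⧸ (Ideal.span {(2 : A)} • (⊤ : Submodule A W))

theorem le_ker_two_smul (h4 : (2 : A) * 2 = 0) (b : LinearMap.BilinForm A W) :
    Ideal.span {(2 : A)} • (⊤ : Submodule A W) ≤ LinearMap.ker ((2 : A) • b) := by
  rw [Submodule.smul_le]
  intro r hr w _
  obtain ⟨s, rfl⟩ := Ideal.mem_span_singleton'.1 hr
  rw [LinearMap.mem_ker, map_smul, LinearMap.smul_apply, smul_smul, mul_assoc,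
    h4, mul_zero, zero_smul]

/-- If `4 = 0` in `A`: the form `β = 2b` on `V = W / 2W`, with values in `A`, induced by a
bilinear form `b` on `W`: `β(v mod 2, w mod 2) = 2 b(v, w)`. -/
def twiceForm (h4 : (2 : A) * 2 = 0) (b : LinearMap.BilinForm A W) :
    LinearMap.BilinForm A (Reduction A W) :=
  LinearMap.liftQ₂ _ _ ((2 : A) • b) (le_ker_two_smul h4 b) (le_ker_two_smul h4 b.flip)

theorem twiceForm_mk (h4 : (2 : A) * 2 = 0) (b : LinearMap.BilinForm A W) (v w : W) :
    twiceForm h4 b (Submodule.Quotient.mk v) (Submodule.Quotient.mk w) = 2 * b v w := rfl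

end Reduction

section Cocycle

variable {K : Type*} [Field K] [Algebra ℤ_[2] K]
  {W : Type*} [AddCommGroup W] [Module (ResidueRing K) W]

/-- The cocycle `β` on `V = W / 2W` with values in `R` attached to a Lagrangian splitting of `W`:
`β((l₁, m₁), (l₂, m₂)) = 2 ω(l₁, m₂)`. -/
def cocycle {ω : LinearMap.BilinForm (ResidueRing K) W} (S : LagrangianSplitting ω) :
    LinearMap.BilinForm (ResidueRing K) (Reduction (ResidueRing K) W) :=
  twiceForm (two_mul_two K) S.form

end Cocycle

/-! ### Heisenberg groups -/

/-- The Heisenberg group `H_β(V) = V × R` of a bilinear form `β` on `V` with values in `R`. -/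
@[ext]
structure Heisenberg {A V : Type*} [CommRing A] [AddCommGroup V] [Module A V]
    (β : LinearMap.BilinForm A V) where
  /-- the component in `V` -/
  vec : V
  /-- the central component -/
  cen : A

namespace Heisenberg

variable {A V : Type*} [CommRing A] [AddCommGroup V] [Module A V] {β : LinearMap.BilinForm A V}

/-- The multiplication `(v₁, z₁) · (v₂, z₂) = (v₁ + v₂, z₁ + z₂ + β(v₁, v₂))`. -/
instance : Mul (Heisenberg β) := ⟨fun x y => ⟨x.vec + y.vec, x.cen + y.cen + β x.vec y.vec⟩⟩

instance : One (Heisenberg β) := ⟨⟨0, 0⟩⟩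

instance : Inv (Heisenberg β) := ⟨fun x => ⟨-x.vec, -x.cen + β x.vec x.vec⟩⟩

@[simp] theorem mul_vec (x y : Heisenberg β) : (x * y).vec = x.vec + y.vec := rfl

@[simp] theorem mul_cen (x y : Heisenberg β) :
    (x * y).cen = x.cen + y.cen + β x.vec y.vec := rfl

@[simp] theorem one_vec : (1 : Heisenberg β).vec = 0 := rfl

@[simp] theorem one_cen : (1 : Heisenberg β).cen = 0 := rfl

@[simp] theorem inv_vec (x : Heisenberg β) : (x⁻¹).vec = -x.vec := rfl

@[simp] theorem inv_cen (x : Heisenberg β) : (x⁻¹).cen = -x.cen + β x.vec x.vec := rfl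

instance : Group (Heisenberg β) :=
  Group.ofLeftAxioms
    (fun x y z => by
      ext
      · simp [add_assoc]
      · simp only [mul_cen, mul_vec, map_add, LinearMap.add_apply]
        ring)
    (fun x => by ext <;> simp)
    (fun x => by ext <;> simp)

end Heisenberg

/-- The affine symplectic group: the automorphisms of the Heisenberg group that act trivially on
its center, with composition as multiplication. -/
def ASp {A V : Type*} [CommRing A] [AddCommGroup V] [Module A V]
    (β : LinearMap.BilinForm A V) : Subgroup (MulAut (Heisenberg β)) where
  carrier := {g | ∀ z ∈ Subgroup.center (Heisenberg β), g z = z}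
  one_mem' := fun _ _ => rfl
  mul_mem' := fun {g h} hg hh z hz => by rw [MulAut.mul_apply, hh z hz, hg z hz]
  inv_mem' := fun {g} hg z hz => by
    rw [MulAut.inv_apply, MulEquiv.symm_apply_eq, hg z hz]

/-! ### Heisenberg representations, projective representations, central extensions -/

/-- The projective general linear group `PGL(E) = GL(E) / center`. -/
abbrev PGL (E : Type*) [AddCommGroup E] [Module ℂ E] : Type _ :=
  LinearMap.GeneralLinearGroup ℂ E ⧸ Subgroup.center (LinearMap.GeneralLinearGroup ℂ E)

/-- `π` is a Heisenberg representation with central character `χ`: it is irreducible and the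
central element `(0, z)` acts by the scalar `χ z`. -/
structure IsHeisenbergRep {A V : Type*} [CommRing A] [AddCommGroup V] [Module A V]
    {β : LinearMap.BilinForm A V} (χ : AddChar A ℂ) {E : Type*} [AddCommGroup E] [Module ℂ E]
    (π : Representation ℂ (Heisenberg β) E) : Prop where
  irreducible : π.IsIrreducible
  central : ∀ z : A, π ⟨0, z⟩ = χ z • LinearMap.id

/-- `σ : ASp(V) → PGL(E)` is the projective Weil representation attached to `π`: every
representative `T` of `σ g` satisfies `T π(h) T⁻¹ = π(g(h))` for all `h`. -/
def IsProjectiveWeilRep {A V : Type*} [CommRing A] [AddCommGroup V] [Module A V]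
    {β : LinearMap.BilinForm A V} {E : Type*} [AddCommGroup E] [Module ℂ E]
    (π : Representation ℂ (Heisenberg β) E) (σ : ASp β →* PGL E) : Prop :=
  ∀ (g : ASp β) (T : LinearMap.GeneralLinearGroup ℂ E), (QuotientGroup.mk T : PGL E) = σ g →
    ∀ h : Heisenberg β, (T : E →ₗ[ℂ] E) ∘ₗ π h ∘ₗ ((T⁻¹ : LinearMap.GeneralLinearGroup ℂ E) :
      E →ₗ[ℂ] E) = π ((g : MulAut (Heisenberg β)) h)

/-- A group extension is central if the image of its kernel is central. -/
def IsCentralExtension {N E G : Type*} [Group N] [Group E] [Group G]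
    (X : GroupExtension N E G) : Prop :=
  X.inl.range ≤ Subgroup.center E

end

end WeilCharTwo

namespace WeilCharTwo

noncomputable section

/-! ### The ring `ℤ[i, 1/2]` -/

/-! The Lagrangian splitting gives $V=P\oplus Q$, with $\beta$ factoring through $P\times Q$, and
the pairing $\psi\circ\beta$ there is nondegenerate. Thus $H(V)$ acts on functions on $Q$ by
translations and phases (`Polarization.model`). This representation is irreducible, and by Stone–von
Neumann (`exists_linearEquiv`) it is the only Heisenberg representation up to isomorphism. An
automorphism $g$ fixing the center preserves the central character, so the model and its twist by
$g$ are intertwined by an operator, unique up to scalar by Schur's lemma. These operators give the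
projective representation.

To cut the scalars down to $\mu_4$, only unitary intertwiners with entries in $\mathbb{Z}[i,1/2]$
are kept. They form a group, and the scalars among them are exactly $\mu_4$ (`pow_four_eq_one`): up
to $\mu_4$, the only prime above $2$ is $1+i$, and it is not unimodular. One such intertwiner exists
for each $g$ (`exists_isWeilOperator`): the image of the delta function at $0$ is an average, over
the $g$-twisted action of $P$, of a phase times a delta function. Its squared norm is a power of
$2$, and $(1-i)/2\in\mathbb{Z}[i,1/2]$ has squared modulus $1/2$, so it can be normalized inside the
ring. The pairs $(g,T)$ are then $AMp(V)$.

Nondegeneracy is the arithmetic input: $K$ being unramified, the trace is surjective modulo $2$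
(`exists_psi_ne_one`). -/

open Complex in
/-- The ring `ℤ[i, 1/2]`, as a subring of `ℂ`. -/
def dyadicGaussian : Subring ℂ where
  carrier := {z | ∃ (k : ℕ) (a b : ℤ), 2 ^ k * z = a + b * I}
  zero_mem' := ⟨0, 0, 0, by simp⟩
  one_mem' := ⟨0, 1, 0, by simp⟩
  add_mem' := by
    rintro x y ⟨k, a, b, hx⟩ ⟨l, c, d, hy⟩
    refine ⟨k + l, 2 ^ l * a + 2 ^ k * c, 2 ^ l * b + 2 ^ k * d, ?_⟩
    push_cast
    rw [pow_add]
    linear_combination 2 ^ l * hx + 2 ^ k * hy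
  mul_mem' := by
    rintro x y ⟨k, a, b, hx⟩ ⟨l, c, d, hy⟩
    refine ⟨k + l, a * c - b * d, a * d + b * c, ?_⟩
    push_cast
    rw [pow_add]
    linear_combination (2 ^ l * y) * hx + (a + b * I) * hy + b * d * I_sq
  neg_mem' := by
    rintro x ⟨k, a, b, hx⟩
    refine ⟨k, -a, -b, ?_⟩
    push_cast
    linear_combination -hx

namespace dyadicGaussian

open Complex

theorem I_mem : I ∈ dyadicGaussian := ⟨0, 0, 1, by simp⟩

theorem half_one_sub_I_mem : (1 - I) / 2 ∈ dyadicGaussian :=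
  ⟨1, 1, -1, by push_cast; ring⟩

theorem star_mem {z : ℂ} (hz : z ∈ dyadicGaussian) : star z ∈ dyadicGaussian := by
  obtain ⟨k, a, b, h⟩ := hz
  refine ⟨k, a, -b, ?_⟩
  have := congrArg (starRingEnd ℂ) h
  simp only [map_mul, map_pow, map_add, map_ofNat, map_intCast, conj_I] at this
  rw [← starRingEnd_apply, this]
  push_cast
  ring

theorem mem_of_pow_four_eq_one {z : ℂ} (hz : z ^ 4 = 1) : z ∈ dyadicGaussian := by
  have h : (z - 1) * (z + 1) * ((z - I) * (z + I)) = 0 := by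
    linear_combination hz - (z ^ 2 - 1) * I_sq
  rcases mul_eq_zero.1 h with h | h <;> rcases mul_eq_zero.1 h with h | h
  · rw [sub_eq_zero.1 h]; exact one_mem _
  · rw [eq_neg_of_add_eq_zero_left h]; exact neg_mem (one_mem _)
  · rw [sub_eq_zero.1 h]; exact I_mem
  · rw [eq_neg_of_add_eq_zero_left h]; exact neg_mem I_mem

/-- Descent on `k`: squares are $0$ or $1$ modulo $4$, so a sum of two squares divisible by $4$ has
both terms even. -/
theorem sq_add_sq_eq_four_pow (k : ℕ) : ∀ a b : ℤ, a ^ 2 + b ^ 2 = 4 ^ k →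
    ∃ c d : ℤ, a = 2 ^ k * c ∧ b = 2 ^ k * d ∧ c ^ 2 + d ^ 2 = 1 := by
  induction k with
  | zero => intro a b h; exact ⟨a, b, by simp, by simp, by simpa using h⟩
  | succ k ih =>
    intro a b h
    have ha : Even a ∧ Even b := by
      have h4 : (4 : ℤ) ∣ a ^ 2 + b ^ 2 := h ▸ Dvd.intro_left (4 ^ k) (pow_succ 4 k).symm
      rcases Int.even_or_odd' a with ⟨c, rfl | rfl⟩ <;>
        rcases Int.even_or_odd' b with ⟨d, rfl | rfl⟩ <;> ring_nf at h4 <;>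
        first | exact ⟨even_two_mul c, even_two_mul d⟩ | omega
    obtain ⟨⟨a, rfl⟩, ⟨b, rfl⟩⟩ := ha
    obtain ⟨c, d, rfl, rfl, hcd⟩ := ih a b (by rw [pow_succ (4 : ℤ) k] at h; linarith)
    exact ⟨c, d, by ring, by ring, hcd⟩

/-- Clearing the denominator $2^k$ turns unimodularity into $a^2+b^2=4^k$. The descent cancels the
denominator, so $z$ is a Gaussian integer of norm $1$. -/
theorem pow_four_eq_one {z : ℂ} (hz : z ∈ dyadicGaussian) (h1 : star z * z = 1) : z ^ 4 = 1 := by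
  obtain ⟨k, a, b, h⟩ := hz
  have hab : a ^ 2 + b ^ 2 = 4 ^ k := by
    have hs := congrArg (starRingEnd ℂ) h
    simp only [map_mul, map_pow, map_add, map_ofNat, map_intCast, conj_I] at hs
    have : ((a ^ 2 + b ^ 2 : ℤ) : ℂ) = ((4 ^ k : ℤ) : ℂ) := by
      push_cast
      rw [← starRingEnd_apply] at h1
      have h4 : (4 : ℂ) ^ k = 2 ^ k * 2 ^ k := by rw [← mul_pow]; norm_num
      rw [h4]
      linear_combination (2 ^ k * 2 ^ k) * h1 - (2 ^ k * z) * hs - (a + b * -I) * h + b ^ 2 * I_sq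
    exact_mod_cast this
  obtain ⟨c, d, rfl, rfl, hcd⟩ := sq_add_sq_eq_four_pow k a b hab
  have hz : z = c + d * I := by
    apply mul_left_cancel₀ (pow_ne_zero k (two_ne_zero (α := ℂ)))
    rw [h]; push_cast; ring
  have hcd' : (c = 0 ∧ d ^ 2 = 1) ∨ (d = 0 ∧ c ^ 2 = 1) := by
    by_cases hc : c = 0
    · left; subst hc; simpa using hcd
    · right
      have : 0 < c ^ 2 := by positivity
      have hd : d ^ 2 = 0 := by nlinarith [sq_nonneg d]
      exact ⟨by simpa using hd, by omega⟩
  have hI : I ^ 4 = 1 := I_pow_four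
  rcases hcd' with ⟨rfl, hd⟩ | ⟨rfl, hc⟩
  · have hd' : (d : ℂ) ^ 2 = 1 := by exact_mod_cast hd
    rw [hz, Int.cast_zero, zero_add, mul_pow, hI, mul_one, show 4 = 2 * 2 from rfl, pow_mul, hd',
      one_pow]
  · have hc' : (c : ℂ) ^ 2 = 1 := by exact_mod_cast hc
    rw [hz, Int.cast_zero, zero_mul, add_zero, show 4 = 2 * 2 from rfl, pow_mul, hc', one_pow]

end dyadicGaussian

/-! ### Generalities on representations -/

section Irreducible

variable {G E : Type*} [Group G] [AddCommGroup E] [Module ℂ E] {π : Representation ℂ G E}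

theorem isIrreducible_of_forall_submodule [Nontrivial E]
    (h : ∀ U : Submodule ℂ E, (∀ g, ∀ x ∈ U, π g x ∈ U) → U ≠ ⊥ → U = ⊤) : π.IsIrreducible where
  exists_pair_ne := ⟨⊥, ⊤, fun h => bot_ne_top (congrArg Subrepresentation.toSubmodule h :
    (⊥ : Submodule ℂ E) = ⊤)⟩
  eq_bot_or_eq_top U := by
    by_cases hU : U.toSubmodule = ⊥
    · exact Or.inl (Subrepresentation.toSubmodule_injective hU)
    · exact Or.inr (Subrepresentation.toSubmodule_injective
        (h _ (fun g x hx => U.apply_mem_toSubmodule g hx) hU))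

theorem eq_top_of_isIrreducible (hπ : π.IsIrreducible) (U : Submodule ℂ E)
    (hU : ∀ g, ∀ x ∈ U, π g x ∈ U) (hne : U ≠ ⊥) : U = ⊤ := by
  rcases hπ.eq_bot_or_eq_top ⟨U, fun g x hx => hU g x hx⟩ with h | h
  · exact absurd (congrArg Subrepresentation.toSubmodule h) hne
  · exact congrArg Subrepresentation.toSubmodule h

theorem nontrivial_of_isIrreducible (hπ : π.IsIrreducible) : Nontrivial E := by
  by_contra hE
  rw [not_nontrivial_iff_subsingleton] at hE
  obtain ⟨U, U', hne⟩ := hπ.exists_pair_ne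
  exact hne (Subrepresentation.toSubmodule_injective (Subsingleton.elim _ _))

theorem isIrreducible_of_linearEquiv (hπ : π.IsIrreducible) {F : Type*} [AddCommGroup F]
    [Module ℂ F] (π' : Representation ℂ G F) (e : E ≃ₗ[ℂ] F)
    (he : ∀ g x, e (π g x) = π' g (e x)) : π'.IsIrreducible := by
  have := nontrivial_of_isIrreducible hπ
  have : Nontrivial F := e.symm.toEquiv.nontrivial
  refine isIrreducible_of_forall_submodule fun U hU hne => ?_
  have h : U.comap (e : E →ₗ[ℂ] F) = ⊤ := by
    refine eq_top_of_isIrreducible hπ _ (fun g x hx => ?_) fun h => hne ?_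
    · simpa [he] using hU g _ hx
    · rw [eq_bot_iff] at h ⊢
      intro x hx
      simpa using h (show e.symm x ∈ _ by simpa using hx)
  rw [eq_top_iff]
  intro x _
  have : e.symm x ∈ U.comap (e : E →ₗ[ℂ] F) := h ▸ Submodule.mem_top
  simpa using this

end Irreducible

theorem exists_natCard_eq_two_pow (B : Type*) [AddCommGroup B] [Finite B]
    (h : ∀ b : B, b + b = 0) : ∃ k : ℕ, Nat.card B = 2 ^ k := by
  let : Module (ZMod 2) B := AddCommGroup.zmodModule (fun b => by rw [two_nsmul, h])
  exact ⟨_, by simpa using Module.natCard_eq_pow_finrank (K := ZMod 2) (V := B)⟩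


/-! ### Polarizations and the Schrödinger model -/

/-- A polarization of a form `β` on an elementary abelian `2`-group `V`, relative to a character
`χ` of order dividing `4`: a decomposition `V = P ⊕ Q` such that `β` factors through `P × Q`,
where `χ ∘ β` is nondegenerate. -/
structure Polarization {A V : Type*} [CommRing A] [AddCommGroup V] [Module A V]
    (β : LinearMap.BilinForm A V) (χ : AddChar A ℂ) where
  /-- the first summand -/
  P : Submodule A V
  /-- the second summand -/
  Q : Submodule A V
  isCompl : IsCompl P Q
  add_self : ∀ v : V, v + v = 0
  apply_right : ∀ v, ∀ w ∈ P, β v w = 0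
  apply_left : ∀ v ∈ Q, ∀ w, β v w = 0
  exists_left : ∀ y ∈ Q, y ≠ 0 → ∃ x ∈ P, χ (β x y) ≠ 1
  exists_right : ∀ x ∈ P, x ≠ 0 → ∃ y ∈ Q, χ (β x y) ≠ 1
  pow_four : ∀ z, χ z ^ 4 = 1

namespace Polarization

variable {A V : Type*} [CommRing A] [AddCommGroup V] [Module A V]
  {β : LinearMap.BilinForm A V} {χ : AddChar A ℂ} (D : Polarization β χ)

/-- The projection of `V` onto `Q` along `P`. -/
def proj : V →ₗ[A] D.Q := D.Q.projectionOnto D.P D.isCompl.symm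

@[simp] theorem proj_coe (y : D.Q) : D.proj y = y := Submodule.projectionOnto_apply_left _ y

theorem sub_proj_mem (v : V) : v - D.proj v ∈ D.P := by
  rw [← Submodule.projectionOnto_apply_eq_zero_iff D.isCompl.symm, map_sub]
  exact sub_eq_zero.2 (D.proj_coe _).symm

theorem proj_of_mem {x : V} (hx : x ∈ D.P) : D.proj x = 0 :=
  (Submodule.projectionOnto_apply_eq_zero_iff D.isCompl.symm).2 hx

theorem apply_proj (v w : V) : β v (D.proj w) = β v w := by
  have h := D.apply_right v _ (D.sub_proj_mem w)
  rw [map_sub] at h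
  exact (sub_eq_zero.1 h).symm

theorem apply_add_self (D : Polarization β χ) (v w : V) : β v w + β v w = 0 := by
  rw [← LinearMap.add_apply, ← map_add, D.add_self, map_zero, LinearMap.zero_apply]

theorem add_self_left (y : D.P) : y + y = 0 := Subtype.ext (D.add_self _)

theorem add_self_right (y : D.Q) : y + y = 0 := Subtype.ext (D.add_self _)

theorem star_mul_self (D : Polarization β χ) (z : A) : star (χ z) * χ z = 1 := by
  have := Complex.norm_eq_one_of_pow_eq_one (D.pow_four z) (by norm_num)
  rw [← starRingEnd_apply, mul_comm, Complex.mul_conj, Complex.normSq_eq_norm_sq, this]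
  simp

/-- Orthogonality of characters: for $y\ne0$ nondegeneracy makes $x\mapsto\chi(\beta(x,y))$ a
nontrivial character of $P$. -/
theorem sum_apply_left [Fintype D.P] [DecidableEq D.Q] (y : D.Q) :
    ∑ x : D.P, χ (β x y) = if y = 0 then (Fintype.card D.P : ℂ) else 0 := by
  split_ifs with hy
  · simp [hy]
  · let θ : AddChar D.P ℂ := χ.compAddMonoidHom
      (((β.flip y).comp D.P.subtype : D.P →ₗ[A] A) : D.P →+ A)
    obtain ⟨x, hx, hne⟩ := D.exists_left y y.2 (by simpa using hy)
    exact AddChar.sum_eq_zero_iff_ne_zero (ψ := θ).2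
      fun h => hne (DFunLike.congr_fun h (⟨x, hx⟩ : D.P))

theorem sum_apply_right [Fintype D.Q] [DecidableEq D.P] (x : D.P) :
    ∑ y : D.Q, χ (β x y) = if x = 0 then (Fintype.card D.Q : ℂ) else 0 := by
  split_ifs with hx
  · simp [hx]
  · let θ : AddChar D.Q ℂ := χ.compAddMonoidHom
      (((β x).comp D.Q.subtype : D.Q →ₗ[A] A) : D.Q →+ A)
    obtain ⟨y, hy, hne⟩ := D.exists_right x x.2 (by simpa using hx)
    exact AddChar.sum_eq_zero_iff_ne_zero (ψ := θ).2
      fun h => hne (DFunLike.congr_fun h (⟨y, hy⟩ : D.Q))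

/-- The Schrödinger model: the Heisenberg representation on the functions on `Q`. -/
def model : Representation ℂ (Heisenberg β) (D.Q → ℂ) where
  toFun h :=
    { toFun f y := χ (h.cen + β h.vec (y + D.proj h.vec : D.Q)) * f (y + D.proj h.vec)
      map_add' f f' := by ext y; simp [mul_add]
      map_smul' c f := by ext y; simp [mul_left_comm] }
  map_one' := by ext; simp
  map_mul' h h' := by
    ext1 f
    funext y
    simp only [Module.End.mul_apply, LinearMap.coe_mk, AddHom.coe_mk, Heisenberg.mul_vec,
      Heisenberg.mul_cen]
    rw [← mul_assoc, ← AddChar.map_add_eq_mul]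
    congr 2
    · simp only [map_add, LinearMap.add_apply, Submodule.coe_add, apply_proj]
      -- The cocycle and the translation by `D.proj h'.vec` each contribute $\beta(v,v')$ on the
      -- side of the product. They cancel because $2V=0$.
      linear_combination D.apply_add_self h.vec h'.vec
    · rw [map_add, add_assoc]

theorem model_apply (h : Heisenberg β) (f : D.Q → ℂ) (y : D.Q) :
    D.model h f y = χ (h.cen + β h.vec (y + D.proj h.vec : D.Q)) * f (y + D.proj h.vec) := rfl

theorem model_central (z : A) : D.model ⟨0, z⟩ = χ z • LinearMap.id := by
  ext1 f; funext y; simp [model_apply]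

theorem model_single [DecidableEq D.Q] (h : Heisenberg β) (y : D.Q) :
    D.model h (Pi.single y 1) =
      χ (h.cen + β h.vec y) • (Pi.single (y + D.proj h.vec) 1 : D.Q → ℂ) := by
  funext t
  have h2 : t + D.proj h.vec + D.proj h.vec = t := by
    rw [add_assoc, D.add_self_right, add_zero]
  rw [model_apply, Pi.smul_apply, smul_eq_mul]
  by_cases ht : t + D.proj h.vec = y
  · rw [ht, ← ht, h2]; simp
  · rw [Pi.single_eq_of_ne ht, Pi.single_eq_of_ne, mul_zero, mul_zero]
    rintro rfl
    exact ht (by rw [add_assoc, D.add_self_right, add_zero])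

theorem model_dotProduct [Fintype D.Q] (h : Heisenberg β) (f f' : D.Q → ℂ) :
    star (D.model h f) ⬝ᵥ D.model h f' = star f ⬝ᵥ f' := by
  simp only [dotProduct, Pi.star_apply, model_apply, star_mul']
  rw [← Equiv.sum_comp (Equiv.addRight (D.proj h.vec)) (fun y => star (f y) * f' y)]
  refine Finset.sum_congr rfl fun y _ => ?_
  rw [mul_mul_mul_comm, D.star_mul_self, one_mul]
  rfl

theorem model_mem_dyadicGaussian (h : Heisenberg β) {f : D.Q → ℂ} (hf : ∀ y, f y ∈ dyadicGaussian)
    (y : D.Q) : D.model h f y ∈ dyadicGaussian :=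
  mul_mem (dyadicGaussian.mem_of_pow_four_eq_one (D.pow_four _)) (hf _)

/-! ### Representations with central character `χ` -/

section CentralCharacter

variable {E : Type*} [AddCommGroup E] [Module ℂ E] {π : Representation ℂ (Heisenberg β) E}

theorem map_mk (hπ : ∀ z, π ⟨0, z⟩ = χ z • LinearMap.id) (v : V) (z : A) (e : E) :
    π ⟨v, z⟩ e = χ z • π ⟨v, 0⟩ e := by
  have : (⟨v, z⟩ : Heisenberg β) = ⟨0, z⟩ * ⟨v, 0⟩ := by ext <;> simp
  rw [this, map_mul, hπ]
  rfl

theorem map_mk_zero (e : E) : π ⟨0, 0⟩ e = e := LinearMap.congr_fun (map_one π) e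

theorem map_mk_map_mk (hπ : ∀ z, π ⟨0, z⟩ = χ z • LinearMap.id) (v w : V) (e : E) :
    π ⟨v, 0⟩ (π ⟨w, 0⟩ e) = χ (β v w) • π ⟨v + w, 0⟩ e := by
  rw [← Module.End.mul_apply, ← map_mul, ← map_mk hπ]
  congr 2
  ext <;> simp

theorem map_left_map_right (hπ : ∀ z, π ⟨0, z⟩ = χ z • LinearMap.id) (x : D.P) (y : D.Q) (e : E) :
    π ⟨x, 0⟩ (π ⟨y, 0⟩ e) = χ (β x y) • π ⟨y, 0⟩ (π ⟨x, 0⟩ e) := by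
  rw [map_mk_map_mk hπ, map_mk_map_mk hπ, D.apply_left y y.2, AddChar.map_zero_eq_one, one_smul,
    add_comm]

theorem map_left_map_left (hπ : ∀ z, π ⟨0, z⟩ = χ z • LinearMap.id) (x x' : D.P) (e : E) :
    π ⟨x, 0⟩ (π ⟨x', 0⟩ e) = π ⟨(x + x' : D.P), 0⟩ e := by
  rw [map_mk_map_mk hπ, D.apply_right _ _ x'.2, AddChar.map_zero_eq_one, one_smul,
    Submodule.coe_add]

variable (π) in
/-- The (unnormalized) average of a vector over `P`. -/
def average [Fintype D.P] : E →ₗ[ℂ] E := ∑ x : D.P, π ⟨x, 0⟩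

theorem average_apply [Fintype D.P] (e : E) : D.average π e = ∑ x : D.P, π ⟨x, 0⟩ e :=
  LinearMap.sum_apply _ _ _

theorem map_average [Fintype D.P] (hπ : ∀ z, π ⟨0, z⟩ = χ z • LinearMap.id) (x : D.P) (e : E) :
    π ⟨x, 0⟩ (D.average π e) = D.average π e := by
  simp only [average_apply, map_sum, D.map_left_map_left hπ]
  exact Equiv.sum_comp (Equiv.addLeft x) (fun x' : D.P => π ⟨x', 0⟩ e)

theorem average_map [Fintype D.P] (hπ : ∀ z, π ⟨0, z⟩ = χ z • LinearMap.id) (x : D.P) (e : E) :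
    D.average π (π ⟨x, 0⟩ e) = D.average π e := by
  simp only [average_apply, D.map_left_map_left hπ]
  exact Equiv.sum_comp (Equiv.addRight x) (fun x' : D.P => π ⟨x', 0⟩ e)

/-- Fourier inversion on $P$: translating by $y\in Q$ turns the average into the projection to the
$P$-eigenspace of character $\chi(\beta(\cdot,y))$. These projections sum to a multiple of $e$, so
they cannot all vanish. -/
theorem exists_average_ne_zero [Fintype D.P] [Fintype D.Q]
    (hπ : ∀ z, π ⟨0, z⟩ = χ z • LinearMap.id) {e : E} (he : e ≠ 0) :
    ∃ y : D.Q, D.average π (π ⟨y, 0⟩ e) ≠ 0 := by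
  classical
  by_contra! h
  have h1 : ∀ y : D.Q, ∑ x : D.P, χ (β x y) • π ⟨x, 0⟩ e = 0 := fun y => by
    have h2 := congrArg (π ⟨y, 0⟩) (h y)
    rw [map_zero, average_apply, map_sum] at h2
    rw [← h2]
    refine Finset.sum_congr rfl fun x _ => ?_
    rw [D.map_left_map_right hπ, map_smul, map_mk_map_mk hπ, D.apply_left y y.2,
      AddChar.map_zero_eq_one, one_smul, D.add_self, map_mk_zero]
  have h2 : ∑ y : D.Q, ∑ x : D.P, χ (β x y) • π ⟨x, 0⟩ e = 0 :=
    Finset.sum_eq_zero fun y _ => h1 y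
  rw [Finset.sum_comm] at h2
  simp only [← Finset.sum_smul, D.sum_apply_right, ite_smul, zero_smul] at h2
  rw [Finset.sum_ite_eq' Finset.univ (0 : D.P) (fun x => (Fintype.card D.Q : ℂ) • π ⟨x, 0⟩ e)] at h2
  simp only [Finset.mem_univ, if_true, Submodule.coe_zero, map_mk_zero] at h2
  exact he ((smul_eq_zero_iff_right (Nat.cast_ne_zero.2 Fintype.card_ne_zero)).1 h2)

variable (π) in
/-- The linear map from the Schrödinger model determined by the image `u` of the delta function
at `0`. -/
def transfer [Fintype D.Q] (u : E) : (D.Q → ℂ) →ₗ[ℂ] E :=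
  Fintype.linearCombination ℂ (fun y : D.Q => π ⟨y, 0⟩ u)

theorem transfer_apply [Fintype D.Q] (u : E) (f : D.Q → ℂ) :
    D.transfer π u f = ∑ y : D.Q, f y • π ⟨y, 0⟩ u := rfl

theorem transfer_single [Fintype D.Q] [DecidableEq D.Q] (u : E) (y : D.Q) :
    D.transfer π u (Pi.single y 1) = π ⟨y, 0⟩ u := by
  simp [transfer_apply, Pi.single_apply]

/-- The model is induced from the character of $P\times R$ that is trivial on $P$, so a $P$-fixed
vector determines an intertwiner out of it. -/
theorem map_transfer [Fintype D.Q] (hπ : ∀ z, π ⟨0, z⟩ = χ z • LinearMap.id) {u : E}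
    (hu : ∀ x : D.P, π ⟨x, 0⟩ u = u) (h : Heisenberg β) (f : D.Q → ℂ) :
    π h (D.transfer π u f) = D.transfer π u (D.model h f) := by
  obtain ⟨v, z⟩ := h
  have h1 (y : D.Q) : π ⟨v, z⟩ (π ⟨y, 0⟩ u) =
      χ (z + β v y) • π ⟨(y + D.proj v : D.Q), 0⟩ u := by
    rw [map_mk hπ, map_mk_map_mk hπ, smul_smul, ← AddChar.map_add_eq_mul]
    congr 1
    -- The $P$-component of `v` is inserted next to `u`, which it fixes. No phase arises, since
    -- $\beta$ vanishes when its left argument is in $Q$.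
    conv_rhs => rw [← hu ⟨_, D.sub_proj_mem v⟩, map_mk_map_mk hπ, D.apply_left _ (Subtype.mem _),
      AddChar.map_zero_eq_one, one_smul]
    congr 3
    simp only [Submodule.coe_add]
    abel
  simp only [transfer_apply, map_sum, map_smul, h1]
  rw [← Equiv.sum_comp (Equiv.addRight (D.proj v))]
  refine Finset.sum_congr rfl fun y _ => ?_
  rw [smul_smul, Equiv.coe_addRight, add_assoc, D.add_self_right, add_zero, model_apply, mul_comm]

end CentralCharacter

/-! ### Irreducibility of the model and the Stone–von Neumann theorem -/

section StoneVonNeumann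

theorem model_left (x : D.P) (f : D.Q → ℂ) (y : D.Q) :
    D.model ⟨x, 0⟩ f y = χ (β x y) * f y := by
  simp [model_apply, D.proj_of_mem x.2]

theorem model_right (y : D.Q) (f : D.Q → ℂ) (t : D.Q) : D.model ⟨y, 0⟩ f t = f (t + y) := by
  simp [model_apply, D.apply_left y y.2]

theorem model_right_single [DecidableEq D.Q] (y : D.Q) :
    D.model ⟨y, 0⟩ (Pi.single 0 1) = Pi.single y 1 := by
  simp [model_single]

theorem model_isIrreducible [Finite V] : D.model.IsIrreducible := by
  classical
  let : Fintype D.P := Fintype.ofFinite _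
  let : Fintype D.Q := Fintype.ofFinite _
  refine isIrreducible_of_forall_submodule fun U hU hne => ?_
  obtain ⟨f, hf, hf0⟩ := U.ne_bot_iff.1 hne
  obtain ⟨y₀, hy₀⟩ := Function.ne_iff.1 hf0
  rw [Pi.zero_apply] at hy₀
  -- Translation by `y₀` moves the nonzero value `f y₀` to the origin. Averaging over $P$ then kills
  -- all other values, so an invariant subspace contains the delta function at $0$.
  have h1 : ∑ x : D.P, D.model ⟨x, 0⟩ (D.model ⟨y₀, 0⟩ f) =
      ((Fintype.card D.P : ℂ) * f y₀) • (Pi.single 0 1 : D.Q → ℂ) := by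
    funext y
    rw [Finset.sum_apply]
    simp only [model_left, model_right]
    rw [← Finset.sum_mul, sum_apply_left]
    by_cases hy : y = 0 <;> simp [hy]
  have h2 : (Pi.single 0 1 : D.Q → ℂ) ∈ U := by
    refine (U.smul_mem_iff ?_).1 (h1 ▸ U.sum_mem fun x _ => hU _ _ (hU _ _ hf))
    exact mul_ne_zero (Nat.cast_ne_zero.2 Fintype.card_ne_zero) hy₀
  rw [eq_top_iff, ← (Pi.basisFun ℂ D.Q).span_eq, Submodule.span_le]
  rintro _ ⟨y, rfl⟩
  rw [Pi.basisFun_apply, ← model_right_single]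
  exact hU _ _ h2

/-- **Schur's lemma** for the Schrödinger model. -/
theorem exists_eq_smul_of_commute [Finite V] (T : (D.Q → ℂ) →ₗ[ℂ] (D.Q → ℂ))
    (hT : ∀ h f, T (D.model h f) = D.model h (T f)) : ∃ c : ℂ, T = c • LinearMap.id := by
  classical
  let : Fintype D.Q := Fintype.ofFinite _
  -- The $P$-fixed functions are the multiples of the delta function at $0$, so `T` scales it. Its
  -- $Q$-translates are a basis, hence `T` is a scalar.
  have h0 : T (Pi.single 0 1) = T (Pi.single 0 1) 0 • (Pi.single 0 1 : D.Q → ℂ) := by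
    funext y
    by_cases hy : y = 0
    · simp [hy]
    · obtain ⟨x, hx, hne⟩ := D.exists_left y y.2 (by simpa using hy)
      have h1 : D.model ⟨x, 0⟩ (Pi.single 0 1) = Pi.single 0 1 := by
        simp [model_single, D.proj_of_mem hx]
      have h2 := congrFun (hT ⟨x, 0⟩ (Pi.single 0 1)) y
      rw [h1, D.model_left ⟨x, hx⟩] at h2
      have h3 : T (Pi.single 0 1) y = 0 := by
        by_contra h
        exact hne (mul_right_cancel₀ h (by rw [one_mul]; exact h2.symm))
      simp [h3, hy]
  refine ⟨T (Pi.single 0 1) 0, (Pi.basisFun ℂ D.Q).ext fun y => ?_⟩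
  rw [Pi.basisFun_apply, ← model_right_single, hT]
  conv_lhs => rw [h0]
  rw [map_smul]
  rfl

/-- The **Stone–von Neumann theorem**. -/
theorem exists_linearEquiv [Finite V] {E : Type*} [AddCommGroup E] [Module ℂ E]
    {π : Representation ℂ (Heisenberg β) E} (hπ : IsHeisenbergRep χ π) :
    ∃ e : (D.Q → ℂ) ≃ₗ[ℂ] E, ∀ h f, e (D.model h f) = π h (e f) := by
  classical
  let : Fintype D.P := Fintype.ofFinite _
  let : Fintype D.Q := Fintype.ofFinite _
  have := nontrivial_of_isIrreducible hπ.irreducible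
  obtain ⟨e, he⟩ := exists_ne (0 : E)
  obtain ⟨y, hy⟩ := D.exists_average_ne_zero hπ.central he
  set u := D.average π (π ⟨y, 0⟩ e)
  have hT := D.map_transfer hπ.central (u := u) (fun x => D.map_average hπ.central x _)
  have hT0 : D.transfer π u (Pi.single 0 1) = u := by
    rw [transfer_single]
    exact map_mk_zero u
  have hker : LinearMap.ker (D.transfer π u) = ⊥ := by
    by_contra h
    have := eq_top_of_isIrreducible D.model_isIrreducible _ (fun g x hx => ?_) h
    · exact hy (by rw [← hT0, LinearMap.ker_eq_top.1 this]; rfl)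
    · rw [LinearMap.mem_ker] at hx ⊢
      rw [← hT, hx, map_zero]
  have hrange : LinearMap.range (D.transfer π u) = ⊤ := by
    refine eq_top_of_isIrreducible hπ.irreducible _ ?_ fun h => ?_
    · rintro g _ ⟨f, rfl⟩
      exact ⟨_, (hT g f).symm⟩
    · exact hy (by rw [← hT0, LinearMap.range_eq_bot.1 h]; rfl)
  exact ⟨LinearEquiv.ofBijective _ ⟨LinearMap.ker_eq_bot.1 hker, LinearMap.range_eq_top.1 hrange⟩,
    fun h f => (hT h f).symm⟩

end StoneVonNeumann

end Polarization


namespace Polarization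

variable {A V : Type*} [CommRing A] [AddCommGroup V] [Module A V]
  {β : LinearMap.BilinForm A V} {χ : AddChar A ℂ} (D : Polarization β χ)

/-! ### Unitary intertwiners with entries in `ℤ[i, 1/2]` -/

theorem dotProduct_single_zero [Fintype D.Q] [DecidableEq D.Q] :
    star (Pi.single 0 1 : D.Q → ℂ) ⬝ᵥ Pi.single 0 1 = 1 := by
  simp [dotProduct, Pi.single_apply]

theorem average_mem_dyadicGaussian [Fintype D.P] (g : Heisenberg β → Heisenberg β)
    {f : D.Q → ℂ} (hf : ∀ y, f y ∈ dyadicGaussian) (y : D.Q) :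
    (∑ x : D.P, D.model (g ⟨x, 0⟩) f) y ∈ dyadicGaussian := by
  rw [Finset.sum_apply]
  exact sum_mem fun x _ => D.model_mem_dyadicGaussian _ hf y

/-! ### Unitary actions on functions on $Q$: norms of averages, and isometry of the transfer map. -/

section Invariant

variable [Fintype D.Q] {π : Representation ℂ (Heisenberg β) (D.Q → ℂ)}

theorem dotProduct_average_self [Fintype D.P] (hπ : ∀ z, π ⟨0, z⟩ = χ z • LinearMap.id)
    (hdot : ∀ h f f', star (π h f) ⬝ᵥ π h f' = star f ⬝ᵥ f') (e : D.Q → ℂ) :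
    star (D.average π e) ⬝ᵥ D.average π e =
      Fintype.card D.P * (star e ⬝ᵥ D.average π e) := by
  have h (x : D.P) : star (π ⟨x, 0⟩ e) ⬝ᵥ D.average π e = star e ⬝ᵥ D.average π e := by
    conv_lhs => rw [← D.map_average hπ x e]
    exact hdot _ _ _
  conv_lhs => enter [1]; rw [average_apply]
  rw [star_sum, sum_dotProduct]
  simp [h]

/-- If each operator moves the unit vector `e` to a multiple of `e` or to a vector orthogonal to
`e`, then a nonzero average of `e` over `P` has a power of `2` as its squared norm. -/
theorem exists_dotProduct_average_eq_two_pow [Finite V]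
    [Fintype D.P] (hπ : ∀ z, π ⟨0, z⟩ = χ z • LinearMap.id)
    (hdot : ∀ h f f', star (π h f) ⬝ᵥ π h f' = star f ⬝ᵥ f') {e : D.Q → ℂ}
    (he : star e ⬝ᵥ e = 1) (hmon : ∀ h, star e ⬝ᵥ π h e = 0 ∨ ∃ c : ℂ, π h e = c • e)
    (hne : D.average π e ≠ 0) :
    ∃ k : ℕ, star (D.average π e) ⬝ᵥ D.average π e = 2 ^ k := by
  classical
  -- If $\pi(x)e=ce$ with $c\ne1$, averaging would give zero. So only the stabilizer `B` of `e`
  -- contributes to $\langle e,\mathrm{avg}\rangle$, and the squared norm is $|P|\cdot|B|$, both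
  -- factors being powers of $2$.
  let B : AddSubgroup D.P :=
    { carrier := {x | π ⟨x, 0⟩ e = e}
      zero_mem' := map_mk_zero e
      add_mem' := fun {x x'} hx hx' => by
        rw [Set.mem_ofPred_eq, ← D.map_left_map_left hπ, hx', hx]
      neg_mem' := fun {x} hx => by
        rwa [Set.mem_ofPred_eq, neg_eq_of_add_eq_zero_left (D.add_self_left x)] }
  have h1 (x : D.P) : star e ⬝ᵥ π ⟨x, 0⟩ e = if x ∈ B then 1 else 0 := by
    split_ifs with hx
    · rw [show π ⟨x, 0⟩ e = e from hx, he]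
    · refine (hmon _).resolve_right ?_
      rintro ⟨c, hc⟩
      have h2 := D.average_map hπ x e
      rw [hc, map_smul] at h2
      have hc1 : c = 1 := smul_left_injective ℂ hne (by simpa using h2)
      exact hx (show π ⟨x, 0⟩ e = e by rw [hc, hc1, one_smul])
  have h2 : star e ⬝ᵥ D.average π e = Nat.card B := by
    rw [average_apply, dotProduct_sum]
    simp only [h1]
    rw [Finset.sum_boole, Nat.card_eq_fintype_card, Fintype.card_subtype]
  obtain ⟨k, hk⟩ := exists_natCard_eq_two_pow D.P D.add_self_left
  obtain ⟨l, hl⟩ := exists_natCard_eq_two_pow B (fun b => Subtype.ext (D.add_self_left _))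
  refine ⟨k + l, ?_⟩
  rw [D.dotProduct_average_self hπ hdot, h2, hl, ← Nat.card_eq_fintype_card, hk, pow_add]
  push_cast
  rfl

/-- The translates of $u$ by $Q$ are eigenvectors of $P$ for distinct characters, and $P$ acts
unitarily, so they are orthonormal. -/
theorem dotProduct_transfer (hπ : ∀ z, π ⟨0, z⟩ = χ z • LinearMap.id)
    (hdot : ∀ h f f', star (π h f) ⬝ᵥ π h f' = star f ⬝ᵥ f') {u : D.Q → ℂ}
    (hu : ∀ x : D.P, π ⟨x, 0⟩ u = u) (hu1 : star u ⬝ᵥ u = 1) (f f' : D.Q → ℂ) :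
    star (D.transfer π u f) ⬝ᵥ D.transfer π u f' = star f ⬝ᵥ f' := by
  classical
  have horth (y y' : D.Q) : star (π ⟨y, 0⟩ u) ⬝ᵥ π ⟨y', 0⟩ u = if y = y' then 1 else 0 := by
    split_ifs with hy
    · rw [hy, hdot, hu1]
    · obtain ⟨x, hx, hne⟩ := D.exists_left (y + y' : D.Q) (Subtype.mem _) fun h => hy <| by
        rw [← sub_eq_zero, sub_eq_add_neg, neg_eq_of_add_eq_zero_left (D.add_self_right y')]
        exact Subtype.ext h
      have hxu (t : D.Q) : π ⟨x, 0⟩ (π ⟨t, 0⟩ u) = χ (β x t) • π ⟨t, 0⟩ u := by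
        rw [D.map_left_map_right hπ ⟨x, hx⟩, hu]
      have h := hdot ⟨x, 0⟩ (π ⟨y, 0⟩ u) (π ⟨y', 0⟩ u)
      rw [hxu, hxu, star_smul, smul_dotProduct, dotProduct_smul, smul_eq_mul, smul_eq_mul,
        ← mul_assoc] at h
      -- A nonzero inner product forces $\chi(\beta(x,y))=\chi(\beta(x,y'))$. As this value squares
      -- to $1$, $\chi(\beta(x,y+y'))=1$, against the choice of `x`.
      by_contra h0
      have h3 := mul_right_cancel₀ h0 (h.trans (one_mul _).symm)
      have h4 : χ (β x y) * χ (β x y) = 1 := by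
        rw [← AddChar.map_add_eq_mul, D.apply_add_self, AddChar.map_zero_eq_one]
      apply hne
      rw [Submodule.coe_add, map_add, AddChar.map_add_eq_mul]
      linear_combination χ (β x y) * χ (β x y) * h3 + h4 -
        χ (β x y) * χ (β x y') * D.star_mul_self (β x y)
  simp only [transfer_apply, star_sum, sum_dotProduct, dotProduct_sum, star_smul, smul_dotProduct,
    dotProduct_smul, horth, smul_eq_mul]
  simp [dotProduct, mul_comm]

end Invariant

/-- `T` is a unitary operator with entries in `ℤ[i, 1/2]` that implements the automorphism `g`
on the Schrödinger model. -/
structure IsWeilOperator [Fintype D.Q] (g : ASp β)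
    (T : LinearMap.GeneralLinearGroup ℂ (D.Q → ℂ)) : Prop where
  intertwines : ∀ h f, T.val (D.model h f) = D.model (g.1 h) (T.val f)
  dotProduct : ∀ f f', star (T.val f) ⬝ᵥ T.val f' = star f ⬝ᵥ f'
  mem : ∀ f, (∀ y, f y ∈ dyadicGaussian) → ∀ y, T.val f y ∈ dyadicGaussian

theorem ASp_apply_central (g : ASp β) (z : A) : g.1 ⟨0, z⟩ = ⟨0, z⟩ :=
  g.2 _ (Subgroup.mem_center_iff.2 fun h => by ext <;> simp [add_comm])

open scoped ComplexOrder in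
theorem exists_isWeilOperator [Finite V] [Fintype D.Q] (g : ASp β) :
    ∃ T, D.IsWeilOperator g T := by
  classical
  let : Fintype D.P := Fintype.ofFinite _
  let π : Representation ℂ (Heisenberg β) (D.Q → ℂ) := D.model.comp g.1.toMonoidHom
  have hπg (h : Heisenberg β) : π h = D.model (g.1 h) := rfl
  have hπ (z : A) : π ⟨0, z⟩ = χ z • LinearMap.id := by
    rw [hπg, ASp_apply_central, D.model_central]
  have hdot (h : Heisenberg β) (f f' : D.Q → ℂ) : star (π h f) ⬝ᵥ π h f' = star f ⬝ᵥ f' :=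
    D.model_dotProduct _ _ _
  have h0 : (Pi.single 0 1 : D.Q → ℂ) ≠ 0 := by simp
  obtain ⟨y, hy⟩ := D.exists_average_ne_zero hπ h0
  set e := π ⟨y, 0⟩ (Pi.single 0 1)
  have he1 : star e ⬝ᵥ e = 1 := (hdot _ _ _).trans D.dotProduct_single_zero
  have hemem (t : D.Q) : e t ∈ dyadicGaussian := by
    refine D.model_mem_dyadicGaussian _ (fun t => ?_) t
    by_cases ht : t = 0 <;> simp [ht]
  -- Model operators are monomial: `e` and `π h e` are phases times delta functions, at the same
  -- point or at different points.
  have hmon (h : Heisenberg β) : star e ⬝ᵥ π h e = 0 ∨ ∃ c : ℂ, π h e = c • e := by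
    have he : e = _ := D.model_single (g.1 ⟨y, 0⟩) 0
    rw [he, map_smul, hπg, D.model_single]
    by_cases hq : D.proj (g.1 h).vec = 0
    · right
      rw [hq, add_zero]
      exact ⟨_, smul_comm _ _ _⟩
    · left
      simp [dotProduct, Pi.single_apply, hq]
  obtain ⟨k, hk⟩ := D.exists_dotProduct_average_eq_two_pow hπ hdot he1 hmon hy
  -- The scalar $2^{-k/2}$ need not lie in $\mathbb{Z}[i,1/2]$ when $k$ is odd, so $(1-i)/2$ stands
  -- in for $1/\sqrt2$.
  set c : ℂ := ((1 - Complex.I) / 2) ^ k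
  have hc : star c * c = (1 / 2) ^ k := by
    rw [star_pow, ← mul_pow]
    congr 1
    simp only [← starRingEnd_apply, map_div₀, map_sub, map_one, Complex.conj_I, map_ofNat]
    linear_combination (-1 / 4 : ℂ) * Complex.I_sq
  have hcmem : c ∈ dyadicGaussian := pow_mem dyadicGaussian.half_one_sub_I_mem k
  set u := c • D.average π e with hu
  have hu1 : star u ⬝ᵥ u = 1 := by
    rw [hu, star_smul, smul_dotProduct, dotProduct_smul, hk, smul_eq_mul, smul_eq_mul, ← mul_assoc,
      hc, ← mul_pow]
    norm_num
  have huinv (x : D.P) : π ⟨x, 0⟩ u = u := by rw [hu, map_smul, D.map_average hπ]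
  have humem (t : D.Q) : u t ∈ dyadicGaussian := by
    refine mul_mem hcmem ?_
    rw [average_apply]
    exact D.average_mem_dyadicGaussian g.1 hemem t
  have hTdot := D.dotProduct_transfer hπ hdot huinv hu1
  have hinj : Function.Injective (D.transfer π u) := by
    rw [injective_iff_map_eq_zero]
    intro f hf
    have := hTdot f f
    rw [hf, dotProduct_zero] at this
    exact dotProduct_star_self_eq_zero.1 this.symm
  refine ⟨LinearMap.GeneralLinearGroup.ofLinearEquiv (LinearEquiv.ofInjectiveEndo _ hinj),
    fun h f => (D.map_transfer hπ huinv h f).symm, hTdot, fun f hf t => ?_⟩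
  change D.transfer π u f t ∈ _
  rw [transfer_apply, Finset.sum_apply]
  exact sum_mem fun y _ => mul_mem (hf y) (D.model_mem_dyadicGaussian _ humem t)

theorem val_inv_apply {E : Type*} [AddCommGroup E] [Module ℂ E]
    (T : LinearMap.GeneralLinearGroup ℂ E) (x : E) :
    T.val (T⁻¹.val x) = x :=
  LinearMap.congr_fun T.mul_inv x

theorem inv_val_apply {E : Type*} [AddCommGroup E] [Module ℂ E]
    (T : LinearMap.GeneralLinearGroup ℂ E) (x : E) :
    T⁻¹.val (T.val x) = x :=
  LinearMap.congr_fun T.inv_mul x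

namespace IsWeilOperator

variable {D} [Fintype D.Q] {g g' : ASp β} {T T' : LinearMap.GeneralLinearGroup ℂ (D.Q → ℂ)}

theorem one : D.IsWeilOperator 1 1 := ⟨fun _ _ => rfl, fun _ _ => rfl, fun _ hf => hf⟩

theorem mul (hT : D.IsWeilOperator g T) (hT' : D.IsWeilOperator g' T') :
    D.IsWeilOperator (g * g') (T * T') where
  intertwines h f := by
    change T.val (T'.val _) = _
    rw [hT'.intertwines, hT.intertwines]
    rfl
  dotProduct f f' := (hT.dotProduct _ _).trans (hT'.dotProduct _ _)
  mem f hf := hT.mem _ (hT'.mem f hf)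

theorem inv (hT : D.IsWeilOperator g T) : D.IsWeilOperator g⁻¹ T⁻¹ where
  intertwines h f := by
    have h1 := hT.intertwines (g⁻¹.1 h) (T⁻¹.val f)
    rw [val_inv_apply, show g.1 (g⁻¹.1 h) = h from MulEquiv.apply_symm_apply g.1 h] at h1
    rw [← h1, inv_val_apply]
  dotProduct f f' := by
    rw [← hT.dotProduct, val_inv_apply, val_inv_apply]
  mem f hf y := by
    classical
    -- Unitarity makes $T^{-1}$ the conjugate transpose of $T$, and $\mathbb{Z}[i,1/2]$ is stable
    -- under conjugation.
    have h1 : T⁻¹.val f y = star (T.val (Pi.single y 1)) ⬝ᵥ f := by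
      conv_rhs => rw [← val_inv_apply T f]
      rw [hT.dotProduct]
      simp [_root_.dotProduct, Pi.single_apply]
    rw [h1]
    refine sum_mem fun t _ => mul_mem (dyadicGaussian.star_mem (hT.mem _ (fun s => ?_) t)) (hf t)
    by_cases hs : s = y <;> simp [hs]

end IsWeilOperator

/-! ### The affine metaplectic group -/

/-- The scalar operators, as a homomorphism `ℂˣ → GL(E)`. -/
def scalar (E : Type*) [AddCommGroup E] [Module ℂ E] : ℂˣ →* LinearMap.GeneralLinearGroup ℂ E :=
  Units.map (algebraMap ℂ (Module.End ℂ E) : ℂ →* Module.End ℂ E)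

theorem scalar_val_apply {E : Type*} [AddCommGroup E] [Module ℂ E] (c : ℂˣ) (x : E) :
    (scalar E c).val x = (c : ℂ) • x := rfl

theorem scalar_mul_comm {E : Type*} [AddCommGroup E] [Module ℂ E] (c : ℂˣ)
    (T : LinearMap.GeneralLinearGroup ℂ E) : scalar E c * T = T * scalar E c :=
  Units.ext (Algebra.commutes _ _)

theorem isWeilOperator_one_scalar [Fintype D.Q] {c : ℂˣ} (hc : c ^ 4 = 1) :
    D.IsWeilOperator 1 (scalar _ c) where
  intertwines h f := by simp only [scalar_val_apply, map_smul]; rfl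
  dotProduct f f' := by
    have hc4 : (c : ℂ) ^ 4 = 1 := by rw [← Units.val_pow_eq_pow_val, hc, Units.val_one]
    have h1 : star (c : ℂ) * c = 1 := by
      rw [← starRingEnd_apply, mul_comm, Complex.mul_conj, Complex.normSq_eq_norm_sq,
        Complex.norm_eq_one_of_pow_eq_one hc4 (by norm_num)]
      simp
    simp only [scalar_val_apply]
    rw [star_smul, smul_dotProduct, dotProduct_smul, smul_smul, h1, one_smul]
  mem f hf y := mul_mem (dyadicGaussian.mem_of_pow_four_eq_one
    (by rw [← Units.val_pow_eq_pow_val, hc, Units.val_one])) (hf y)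

theorem exists_scalar_of_isWeilOperator_one [Finite V] [Fintype D.Q]
    {T : LinearMap.GeneralLinearGroup ℂ (D.Q → ℂ)} (hT : D.IsWeilOperator 1 T) :
    ∃ c : ℂˣ, c ^ 4 = 1 ∧ scalar _ c = T := by
  classical
  obtain ⟨c, hc⟩ := D.exists_eq_smul_of_commute T.val hT.intertwines
  have hmem : c ∈ dyadicGaussian := by
    have := hT.mem (Pi.single 0 1) (fun y => by by_cases hy : y = 0 <;> simp [hy]) 0
    simpa [hc] using this
  have hnorm : star c * c = 1 := by
    have := hT.dotProduct (Pi.single 0 1) (Pi.single 0 1)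
    rw [hc, D.dotProduct_single_zero] at this
    simpa [star_smul, smul_dotProduct, dotProduct_smul, D.dotProduct_single_zero, mul_comm] using this
  have h4 := dyadicGaussian.pow_four_eq_one hmem hnorm
  have hc0 : c ≠ 0 := by rintro rfl; simp at h4
  refine ⟨Units.mk0 c hc0, Units.ext (by simpa using h4), Units.ext ?_⟩
  rw [hc]
  rfl

/-- The affine metaplectic group: pairs of `g ∈ ASp(V)` and a unitary operator with entries in
`ℤ[i, 1/2]` that implements `g` on the Schrödinger model. -/
def AMp [Fintype D.Q] : Subgroup (ASp β × LinearMap.GeneralLinearGroup ℂ (D.Q → ℂ)) where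
  carrier := {a | D.IsWeilOperator a.1 a.2}
  one_mem' := IsWeilOperator.one
  mul_mem' := IsWeilOperator.mul
  inv_mem' := IsWeilOperator.inv

/-- The affine metaplectic group as an extension of `ASp(V)` by the fourth roots of unity. -/
def extension [Finite V] [Fintype D.Q] : GroupExtension (rootsOfUnity 4 ℂ) D.AMp (ASp β) where
  inl :=
    { toFun c := ⟨(1, scalar _ c.1), D.isWeilOperator_one_scalar c.2⟩
      map_one' := by simp
      map_mul' c c' := by simp; rfl }
  rightHom := (MonoidHom.fst _ _).comp D.AMp.subtype
  inl_injective c c' h := by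
    have h1 : scalar (D.Q → ℂ) c.1 = scalar (D.Q → ℂ) c'.1 := congrArg (fun a => a.1.2) h
    have h2 := congrFun (LinearMap.congr_fun (congrArg Units.val h1) (fun _ => 1)) 0
    exact Subtype.ext (Units.ext (by simpa [scalar_val_apply] using h2))
  range_inl_eq_ker_rightHom := by
    ext ⟨⟨g, T⟩, hT⟩
    rw [MonoidHom.mem_ker]
    constructor
    · rintro ⟨c, hc⟩
      exact (congrArg (fun a => a.1.1) hc).symm
    · intro hg
      obtain rfl : g = 1 := hg
      obtain ⟨c, hc, rfl⟩ := D.exists_scalar_of_isWeilOperator_one hT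
      exact ⟨⟨c, hc⟩, rfl⟩
  rightHom_surjective g := by
    obtain ⟨T, hT⟩ := D.exists_isWeilOperator g
    exact ⟨⟨(g, T), hT⟩, rfl⟩

theorem isCentralExtension_extension [Finite V] [Fintype D.Q] :
    IsCentralExtension D.extension := by
  rintro _ ⟨c, rfl⟩
  rw [Subgroup.mem_center_iff]
  rintro ⟨⟨g, T⟩, hT⟩
  refine Subtype.ext (Prod.ext ?_ ?_)
  · exact (mul_one g).trans (one_mul g).symm
  · exact (scalar_mul_comm _ _).symm

/-! ### The Weil representation -/

section Weil

variable [Finite V] [Fintype D.Q] {E : Type*} [AddCommGroup E] [Module ℂ E]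
  {π : Representation ℂ (Heisenberg β) E}

/-- **Schur's lemma** for Heisenberg representations. -/
theorem mem_center_of_commute (D : Polarization β χ) (hπ : IsHeisenbergRep χ π) (T : LinearMap.GeneralLinearGroup ℂ E)
    (hT : ∀ h x, T.val (π h x) = π h (T.val x)) :
    T ∈ Subgroup.center (LinearMap.GeneralLinearGroup ℂ E) := by
  obtain ⟨e, he⟩ := D.exists_linearEquiv hπ
  obtain ⟨c, hc⟩ := D.exists_eq_smul_of_commute (e.symm.toLinearMap ∘ₗ T.val ∘ₗ e.toLinearMap)
    fun h f => by simp [he, hT, e.symm_apply_eq]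
  have hT' (x : E) : T.val x = c • x := by
    have := congrArg e (LinearMap.congr_fun hc (e.symm x))
    simpa using this
  rw [Subgroup.mem_center_iff]
  intro S
  refine Units.ext (LinearMap.ext fun x => ?_)
  change S.val (T.val x) = T.val (S.val x)
  rw [hT', hT', map_smul]

/-- Conjugation of operators by a linear equivalence. -/
def conjGL {E F : Type*} [AddCommGroup E] [Module ℂ E] [AddCommGroup F] [Module ℂ F]
    (e : E ≃ₗ[ℂ] F) : LinearMap.GeneralLinearGroup ℂ E →* LinearMap.GeneralLinearGroup ℂ F :=
  Units.map (e.conjRingEquiv : Module.End ℂ E →* Module.End ℂ F)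

/-- The operators of a representation of a group, as elements of `GL(E)`. -/
def toGL {G : Type*} [Group G] (π : Representation ℂ G E) :
    G →* LinearMap.GeneralLinearGroup ℂ E :=
  MonoidHom.toHomUnits π

theorem exists_projectiveWeilRep (hπ : IsHeisenbergRep χ π) :
    ∃ σ : ASp β →* PGL E, IsProjectiveWeilRep π σ ∧
      (∀ σ' : ASp β →* PGL E, IsProjectiveWeilRep π σ' → σ' = σ) ∧
      ∃ ρ : D.AMp →* LinearMap.GeneralLinearGroup ℂ E,
        ∀ a : D.AMp, (QuotientGroup.mk (ρ a) : PGL E) = σ (D.extension.rightHom a) := by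
  obtain ⟨e, he⟩ := D.exists_linearEquiv hπ
  let ρ : D.AMp →* LinearMap.GeneralLinearGroup ℂ E :=
    (conjGL e).comp ((MonoidHom.snd _ _).comp D.AMp.subtype)
  have hρ_apply (a : D.AMp) (x : E) : (ρ a).val x = e (a.1.2.val (e.symm x)) := rfl
  have hρ (a : D.AMp) (h : Heisenberg β) (x : E) :
      (ρ a).val (π h x) = π ((D.extension.rightHom a).1 h) ((ρ a).val x) := by
    rw [hρ_apply, hρ_apply, ← he]
    have : e.symm (π h x) = D.model h (e.symm x) := by rw [e.symm_apply_eq, he, e.apply_symm_apply]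
    rw [this, a.2.intertwines]
    rfl
  -- Over the identity of `ASp β` the operator commutes with $\pi$, hence is central by Schur. So
  -- $\rho$ modulo the center descends to `ASp β`.
  have hker : D.extension.rightHom.ker ≤ ((QuotientGroup.mk' _).comp ρ : D.AMp →* PGL E).ker := by
    intro a ha
    rw [MonoidHom.mem_ker] at ha ⊢
    refine (QuotientGroup.eq_one_iff _).2 (D.mem_center_of_commute hπ _ fun h x => ?_)
    rw [hρ, ha]
    rfl
  let σ : ASp β →* PGL E :=
    D.extension.rightHom.liftOfSurjective D.extension.rightHom_surjective ⟨_, hker⟩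
  have hσ (a : D.AMp) : σ (D.extension.rightHom a) = QuotientGroup.mk (ρ a) :=
    MonoidHom.liftOfRightInverse_comp_apply _ _ _ ⟨_, hker⟩ a
  have key (T : LinearMap.GeneralLinearGroup ℂ E) (g : MulAut (Heisenberg β))
      (hT : ∀ h x, T.val (π h x) = π (g h) (T.val x)) (h : Heisenberg β) :
      T.val ∘ₗ π h ∘ₗ T⁻¹.val = π (g h) := by
    ext x
    rw [LinearMap.comp_apply, LinearMap.comp_apply, hT]
    rw [val_inv_apply]
  refine ⟨σ, ?_, ?_, ρ, fun a => (hσ a).symm⟩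
  · intro g T hTg
    obtain ⟨a, rfl⟩ := D.extension.rightHom_surjective g
    rw [hσ] at hTg
    obtain ⟨Z, hZ, rfl⟩ : ∃ Z ∈ Subgroup.center (LinearMap.GeneralLinearGroup ℂ E), T = ρ a * Z :=
      ⟨(ρ a)⁻¹ * T, QuotientGroup.eq.1 hTg.symm, by group⟩
    refine key _ _ fun h x => ?_
    change (ρ a).val (Z.val (π h x)) = π _ ((ρ a).val (Z.val x))
    rw [← hρ]
    have hπh : π h = (toGL π h).val := rfl
    rw [hπh]
    exact congrArg (ρ a).val (LinearMap.congr_fun (congrArg Units.val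
      (Subgroup.mem_center_iff.1 hZ (toGL π h))).symm x)
  · intro σ' hσ'
    ext g
    obtain ⟨a, rfl⟩ := D.extension.rightHom_surjective g
    obtain ⟨T, hT⟩ := QuotientGroup.mk_surjective (σ' (D.extension.rightHom a))
    rw [hσ, ← hT, QuotientGroup.eq]
    -- Two operators implementing the same automorphism differ by one that commutes with $\pi$,
    -- which gives uniqueness in `PGL E`.
    refine D.mem_center_of_commute hπ _ fun h x => ?_
    have hTh := hσ' _ T hT h
    have hT' (y : E) : T.val (π h y) = π ((D.extension.rightHom a).1 h) (T.val y) := by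
      rw [← hTh]
      exact congrArg (fun z => T.val (π h z)) (inv_val_apply T y).symm
    change T⁻¹.val ((ρ a).val (π h x)) = π h (T⁻¹.val ((ρ a).val x))
    rw [hρ]
    have h1 := hT' (T⁻¹.val ((ρ a).val x))
    have h2 : T.val (T⁻¹.val ((ρ a).val x)) = (ρ a).val x := val_inv_apply T _
    rw [h2] at h1
    rw [← h1]
    exact inv_val_apply T _

end Weil

end Polarization


/-! ### The ring `R` and its trace form -/

section Ring

variable {K : Type*} [Field K] [Algebra ℤ_[2] K]

theorem map_maximalIdeal :
    (IsLocalRing.maximalIdeal ℤ_[2]).map (algebraMap ℤ_[2] (IntegerRing K)) = twoIdeal K := by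
  rw [PadicInt.maximalIdeal_eq_span_p, Ideal.map_span, Set.image_singleton]
  exact congrArg (fun x => Ideal.span {x}) (map_ofNat (algebraMap ℤ_[2] (IntegerRing K)) 2)

variable (K) in
theorem psi_pow_four (z : ResidueRing K) : psi K z ^ 4 = 1 := by
  rw [← AddChar.map_nsmul_eq_pow]
  have : (4 • z : ResidueRing K) = 2 * 2 * z := by rw [nsmul_eq_mul]; norm_num
  rw [this, two_mul_two, zero_mul, AddChar.map_zero_eq_one]

variable [Algebra ℚ_[2] K]

theorem two_ne_zero_integerRing : (2 : IntegerRing K) ≠ 0 := by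
  have : CharZero K := charZero_of_injective_algebraMap (algebraMap ℚ_[2] K).injective
  intro h
  exact two_ne_zero (congrArg Subtype.val h : (2 : K) = 0)

-- In $\mathcal{O}_K$, a domain with $2\ne0$, $2x\in(4)$ forces $x\in(2)$: the annihilator of $2$ in
-- $R$ is $2R$.
variable (K) in
theorem eq_two_mul_of_two_mul_eq_zero {a : ResidueRing K} (ha : 2 * a = 0) :
    ∃ b, a = 2 * b := by
  obtain ⟨x, rfl⟩ := toResidueRing_surjective K a
  rw [← map_ofNat (toResidueRing K) 2, ← map_mul, toResidueRing_eq_zero_iff,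
    Ideal.span_singleton_pow, Ideal.mem_span_singleton, pow_two] at ha
  obtain ⟨y, hy⟩ := ha
  rw [mul_assoc] at hy
  have := mul_left_cancel₀ two_ne_zero_integerRing hy
  exact ⟨toResidueRing K y, by rw [this, map_mul, map_ofNat]⟩

variable [IsScalarTower ℤ_[2] ℚ_[2] K]

theorem isTorsionFree_integerRing : Module.IsTorsionFree ℤ_[2] (IntegerRing K) := by
  have : FaithfulSMul ℤ_[2] K := by
    rw [faithfulSMul_iff_algebraMap_injective, IsScalarTower.algebraMap_eq ℤ_[2] ℚ_[2] K]
    exact (algebraMap ℚ_[2] K).injective.comp (FaithfulSMul.algebraMap_injective ℤ_[2] ℚ_[2])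
  infer_instance

variable [FiniteDimensional ℚ_[2] K]

theorem finite_integerRing : Module.Finite ℤ_[2] (IntegerRing K) :=
  IsIntegralClosure.finite ℤ_[2] ℚ_[2] K (IntegerRing K)

theorem exists_trace_eq_one (k l : Type*) [Field k] [Finite k] [Field l] [Algebra k l]
    [Module.Finite k l] : ∃ x : l, Algebra.trace k l x = 1 :=
  Algebra.trace_surjective k l 1

attribute [local instance] Ideal.Quotient.field in
/-- The trace of an unramified extension is surjective modulo `2`. -/
theorem exists_trace_notMem (hK : IsUnramified K) : ∃ z : IntegerRing K,
    Algebra.trace ℤ_[2] (IntegerRing K) z ∉ IsLocalRing.maximalIdeal ℤ_[2] := by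
  have := finite_integerRing (K := K)
  have := isTorsionFree_integerRing (K := K)
  have : Module.Free ℤ_[2] (IntegerRing K) := inferInstance
  have hmax : ((IsLocalRing.maximalIdeal ℤ_[2]).map
      (algebraMap ℤ_[2] (IntegerRing K))).IsMaximal := by
    rw [map_maximalIdeal]; exact hK
  set k := ℤ_[2] ⧸ IsLocalRing.maximalIdeal ℤ_[2]
  set l := IntegerRing K ⧸ (IsLocalRing.maximalIdeal ℤ_[2]).map
    (algebraMap ℤ_[2] (IntegerRing K))
  have : Finite k := Finite.of_equiv _ (PadicInt.residueField (p := 2)).symm.toEquiv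
  have : Module.Finite k l := Module.Finite.of_restrictScalars_finite ℤ_[2] k l
  obtain ⟨x, hx⟩ := exists_trace_eq_one k l
  obtain ⟨z, rfl⟩ := Ideal.Quotient.mk_surjective x
  refine ⟨z, fun hz => ?_⟩
  have h := Algebra.trace_quotient_mk (R := ℤ_[2]) z
  rw [Ideal.Quotient.eq_zero_iff_mem.2 hz] at h
  exact zero_ne_one (h.symm.trans hx)

-- As $2a\ne0$, $a$ is invertible modulo $2$, so $ra$ can be made congruent modulo $2$ to any chosen
-- $z$. Taking $\mathrm{tr}(z)$ odd gives $\psi(2z)=e^{\pi i\,\mathrm{tr}(z)}=-1$.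
variable (K) in
theorem exists_psi_ne_one (hK : IsUnramified K) {a : ResidueRing K} (ha : 2 * a ≠ 0) :
    ∃ r, psi K (2 * (r * a)) ≠ 1 := by
  obtain ⟨x, rfl⟩ := toResidueRing_surjective K a
  have hx : x ∉ twoIdeal K := fun hx => ha <| by
    obtain ⟨y, rfl⟩ := Ideal.mem_span_singleton.1 hx
    rw [map_mul, map_ofNat, ← mul_assoc, two_mul_two, zero_mul]
  obtain ⟨z, hz⟩ := exists_trace_notMem hK
  obtain ⟨y, i, hi, hy⟩ := Ideal.IsMaximal.exists_inv hK hx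
  obtain ⟨t, rfl⟩ := Ideal.mem_span_singleton.1 hi
  refine ⟨toResidueRing K (z * y), fun h => hz ?_⟩
  have h1 : (2 : ResidueRing K) * (toResidueRing K (z * y) * toResidueRing K x) =
      toResidueRing K (2 * z) := by
    have h2 : z * y * x = z - 2 * (z * t) := by linear_combination z * hy
    rw [← map_mul, h2, map_sub, map_mul _ 2, map_ofNat, mul_sub, ← mul_assoc, two_mul_two, zero_mul,
      sub_zero, map_mul, map_ofNat]
  have h3 : tr K (toResidueRing K (2 * z)) = 0 := by
    apply ZMod.injective_stdAddChar (N := 4)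
    rw [AddChar.map_zero_eq_one]
    rw [h1] at h
    exact h
  rw [tr_toResidueRing, two_mul, map_add, ← two_mul] at h3
  set s := Algebra.trace ℤ_[2] (IntegerRing K) z
  have h4 : (2 : ℤ_[2]) * s ∈ Ideal.span {((2 : ℕ) : ℤ_[2]) ^ 2} := by
    rw [← PadicInt.ker_toZModPow]; exact h3
  rw [Ideal.mem_span_singleton] at h4
  obtain ⟨c, hc⟩ := h4
  rw [PadicInt.maximalIdeal_eq_span_p, Ideal.mem_span_singleton]
  refine ⟨c, mul_left_cancel₀ (two_ne_zero (α := ℤ_[2])) ?_⟩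
  rw [hc]; push_cast; ring

variable (K) in
theorem finite_residueRing : Finite (ResidueRing K) := by
  have := finite_integerRing (K := K)
  have : Finite (ℤ_[2] ⧸ IsLocalRing.maximalIdeal ℤ_[2]) :=
    Finite.of_equiv _ (PadicInt.residueField (p := 2)).symm.toEquiv
  have h1 : Finite (IntegerRing K ⧸ twoIdeal K) := by
    rw [← map_maximalIdeal]
    -- $\mathcal{O}_K/2$ is a finitely generated module over the finite residue field of
    -- $\mathbb{Z}_2$. Finiteness then passes to the quotient by the square of $(2)$.
    have h := Submodule.finite_quotient_smul (IsLocalRing.maximalIdeal ℤ_[2])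
      (N := (⊤ : Submodule ℤ_[2] (IntegerRing K))) Module.Finite.fg_top
    rw [Ideal.smul_top_eq_map] at h
    exact h
  exact Ideal.finite_quotient_pow ⟨{2}, by simp⟩ 2

end Ring


/-! ### The polarization attached to a Lagrangian splitting -/

section Symplectic

variable {A W : Type*} [CommRing A] [AddCommGroup W] [Module A W]

theorem mk_eq_zero_iff_exists_two_smul (w : W) :
    (Submodule.Quotient.mk w : Reduction A W) = 0 ↔ ∃ w' : W, w = (2 : A) • w' := by
  rw [Submodule.Quotient.mk_eq_zero, Submodule.ideal_span_singleton_smul,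
    Submodule.mem_smul_pointwise_iff_exists]
  simp [eq_comm]

theorem exists_two_smul_of_two_smul_eq_zero [Module.Free A W]
    (hA : ∀ a : A, 2 * a = 0 → ∃ b, a = 2 * b) {w : W} (hw : (2 : A) • w = 0) :
    ∃ w' : W, w = (2 : A) • w' := by
  let b := Module.Free.chooseBasis A W
  have h (i) : 2 * b.repr w i = 0 := by
    have := DFunLike.congr_fun (congrArg b.repr hw) i
    simpa using this
  choose c hc using fun i => hA _ (h i)
  refine ⟨∑ i ∈ (b.repr w).support, c i • b i, ?_⟩
  rw [Finset.smul_sum]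
  conv_lhs => rw [← b.linearCombination_repr w, Finsupp.linearCombination_apply, Finsupp.sum]
  exact Finset.sum_congr rfl fun i _ => by rw [smul_smul, ← hc]

namespace LagrangianSplitting

variable {ω : LinearMap.BilinForm A W} (S : LagrangianSplitting ω)

theorem form_apply (v w : W) : S.form v w =
    ω (S.L.projection S.M S.isCompl v) (S.M.projection S.L S.isCompl.symm w) := rfl

theorem apply_eq_zero_of_mem_left {v w : W} (hv : v ∈ S.L) (hw : w ∈ S.L) : ω v w = 0 := by
  rw [← S.lagrangian_left] at hw
  exact hw v hv

theorem apply_eq_zero_of_mem_right {v w : W} (hv : v ∈ S.M) (hw : w ∈ S.M) : ω v w = 0 := by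
  rw [← S.lagrangian_right] at hw
  exact hw v hv

theorem form_of_mem_right (w : W) {m : W} (hm : m ∈ S.M) : S.form w m = ω w m := by
  rw [form_apply, Submodule.projection_apply_of_mem_left _ hm]
  conv_rhs => rw [← Submodule.projection_add_projection_eq_self S.isCompl w]
  rw [map_add, LinearMap.add_apply,
    S.apply_eq_zero_of_mem_right (Submodule.projection_apply_mem _ w) hm, add_zero]

theorem form_of_mem_left (w : W) {l : W} (hl : l ∈ S.L) : S.form l w = ω l w := by
  rw [form_apply, Submodule.projection_apply_of_mem_left _ hl]
  conv_rhs => rw [← Submodule.projection_add_projection_eq_self S.isCompl w]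
  rw [map_add, S.apply_eq_zero_of_mem_left hl (Submodule.projection_apply_mem _ w), zero_add]

theorem isCompl_map_mkQ :
    IsCompl (S.L.map (Ideal.span {(2 : A)} • (⊤ : Submodule A W)).mkQ)
      (S.M.map (Ideal.span {(2 : A)} • (⊤ : Submodule A W)).mkQ) where
  disjoint := by
    rw [Submodule.disjoint_def]
    rintro _ ⟨l, hl, rfl⟩ ⟨m, hm, h⟩
    have h1 : (Submodule.Quotient.mk (l - m) : Reduction A W) = 0 := by
      rw [Submodule.Quotient.mk_sub]
      exact sub_eq_zero.2 h.symm
    obtain ⟨w, hw⟩ := (mk_eq_zero_iff_exists_two_smul _).1 h1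
    -- Projecting $l-m=2w$ to $L$ along $M$ exhibits $l$ itself as twice a vector.
    refine (mk_eq_zero_iff_exists_two_smul _).2 ⟨S.L.projection S.M S.isCompl w, ?_⟩
    rw [← map_smul, ← hw, map_sub, Submodule.projection_apply_of_mem_left _ hl,
      Submodule.projection_apply_of_mem_right _ hm, sub_zero]
  codisjoint := by
    rw [codisjoint_iff, ← Submodule.map_sup, S.isCompl.sup_eq_top, Submodule.map_top,
      Submodule.range_mkQ]

end LagrangianSplitting

end Symplectic

section Cocycle

variable {K : Type*} [Field K] [Algebra ℚ_[2] K] [FiniteDimensional ℚ_[2] K]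
  [Algebra ℤ_[2] K] [IsScalarTower ℤ_[2] ℚ_[2] K]
  {W : Type*} [AddCommGroup W] [Module (ResidueRing K) W]

theorem finite_reduction [Module.Finite (ResidueRing K) W] :
    Finite (Reduction (ResidueRing K) W) := by
  have := finite_residueRing K
  have : Finite W := Module.finite_of_finite (ResidueRing K)
  exact Finite.of_surjective _ (Submodule.mkQ_surjective _)

variable [Module.Free (ResidueRing K) W] {ω : LinearMap.BilinForm (ResidueRing K) W}

/-- Freeness turns $w_0\notin2W$ into $2w_0\neq0$, and perfectness gives $w$ with
$2\omega(w_0,w)\ne0$. Rescaling $w$ makes $\psi$ detect this value. -/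
theorem exists_psi_two_mul_ne_one (hK : IsUnramified K) (hω : IsSymplectic ω) {w₀ : W}
    (hw₀ : (Submodule.Quotient.mk w₀ : Reduction (ResidueRing K) W) ≠ 0) :
    ∃ w, psi K (2 * ω w₀ w) ≠ 1 := by
  have h2 : (2 : ResidueRing K) • w₀ ≠ 0 := fun h => hw₀ <|
    (mk_eq_zero_iff_exists_two_smul _).2
      (exists_two_smul_of_two_smul_eq_zero (fun _ => eq_two_mul_of_two_mul_eq_zero K) h)
  obtain ⟨w, hw⟩ : ∃ w, 2 * ω w₀ w ≠ 0 := by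
    by_contra! h
    refine h2 (hω.perfect.bijective_left.1 ?_)
    ext w
    simpa using h w
  obtain ⟨r, hr⟩ := exists_psi_ne_one K hK hw
  exact ⟨r • w, by rwa [map_smul, smul_eq_mul]⟩

/-- The polarization of `V = W / 2W` by the images of the two Lagrangians. -/
def polarization (hK : IsUnramified K) (hω : IsSymplectic ω) (S : LagrangianSplitting ω) :
    Polarization (cocycle S) (psi K) where
  P := S.L.map (Submodule.mkQ _)
  Q := S.M.map (Submodule.mkQ _)
  isCompl := S.isCompl_map_mkQ
  add_self v := by
    obtain ⟨w, rfl⟩ := Submodule.Quotient.mk_surjective _ v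
    rw [← Submodule.Quotient.mk_add]
    exact (mk_eq_zero_iff_exists_two_smul _).2 ⟨w, (two_smul _ w).symm⟩
  apply_right v := by
    rintro _ ⟨l, hl, rfl⟩
    obtain ⟨w, rfl⟩ := Submodule.Quotient.mk_surjective _ v
    refine (twiceForm_mk _ _ _ _).trans ?_
    rw [S.form_apply, Submodule.projection_apply_of_mem_right _ hl, map_zero, mul_zero]
  apply_left := by
    rintro _ ⟨m, hm, rfl⟩ v
    obtain ⟨w, rfl⟩ := Submodule.Quotient.mk_surjective _ v
    refine (twiceForm_mk _ _ _ _).trans ?_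
    rw [S.form_apply, Submodule.projection_apply_of_mem_right _ hm, map_zero,
      LinearMap.zero_apply, mul_zero]
  exists_left := by
    rintro _ ⟨m, hm, rfl⟩ hne
    obtain ⟨w, hw⟩ := exists_psi_two_mul_ne_one hK hω hne
    -- The sign in `-w` compensates for the swap of arguments: $\omega(-w,m)=\omega(m,w)$. Only the
    -- $L$-component matters, since $M$ is isotropic.
    refine ⟨_, ⟨S.L.projection S.M S.isCompl (-w), Submodule.projection_apply_mem _ _, rfl⟩, ?_⟩
    have : cocycle S (Submodule.Quotient.mk (S.L.projection S.M S.isCompl (-w)))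
        (Submodule.Quotient.mk m) = 2 * ω m w := by
      refine (twiceForm_mk _ _ _ _).trans ?_
      have h : S.form (S.L.projection S.M S.isCompl (-w)) m = S.form (-w) m := by
        rw [S.form_apply, S.form_apply, Submodule.projection_apply_of_mem_left _
          (Submodule.projection_apply_mem _ _)]
      rw [h, S.form_of_mem_right _ hm, map_neg, LinearMap.neg_apply, hω.alt.neg_eq]
    exact this ▸ hw
  exists_right := by
    rintro _ ⟨l, hl, rfl⟩ hne
    obtain ⟨w, hw⟩ := exists_psi_two_mul_ne_one hK hω hne
    refine ⟨_, ⟨S.M.projection S.L S.isCompl.symm w, Submodule.projection_apply_mem _ _, rfl⟩, ?_⟩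
    have : cocycle S (Submodule.Quotient.mk l)
        (Submodule.Quotient.mk (S.M.projection S.L S.isCompl.symm w)) = 2 * ω l w := by
      refine (twiceForm_mk _ _ _ _).trans ?_
      have h : S.form l (S.M.projection S.L S.isCompl.symm w) = S.form l w := by
        rw [S.form_apply, S.form_apply, Submodule.projection_apply_of_mem_left _
          (Submodule.projection_apply_mem _ w)]
      rw [h, S.form_of_mem_left _ hl]
    exact this ▸ hw
  pow_four := psi_pow_four K

end Cocycle

/-- A Heisenberg representation exists in every universe. -/
theorem Polarization.exists_isHeisenbergRep {A V : Type*} [CommRing A] [AddCommGroup V]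
    [Module A V] [Finite V] {β : LinearMap.BilinForm A V} {χ : AddChar A ℂ}
    (D : Polarization β χ) :
    ∃ (E : Type w) (_ : AddCommGroup E) (_ : Module ℂ E) (π : Representation ℂ (Heisenberg β) E),
      IsHeisenbergRep χ π := by
  -- $Q$ is finite, hence has a copy in every universe, and the model is transported to functions on
  -- that copy.
  let e : (D.Q → ℂ) ≃ₗ[ℂ] (Shrink.{w} D.Q → ℂ) :=
    LinearEquiv.funCongrLeft ℂ ℂ (equivShrink.{w} D.Q).symm
  let π : Representation ℂ (Heisenberg β) (Shrink.{w} D.Q → ℂ) :=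
    (e.conjRingEquiv : Module.End ℂ (D.Q → ℂ) →* Module.End ℂ (Shrink.{w} D.Q → ℂ)).comp D.model
  have hπ (h : Heisenberg β) (f : Shrink.{w} D.Q → ℂ) : π h f = e (D.model h (e.symm f)) := rfl
  refine ⟨_, _, _, π, isIrreducible_of_linearEquiv D.model_isIrreducible π e fun h f => ?_,
    fun z => LinearMap.ext fun f => ?_⟩
  · rw [hπ, e.symm_apply_apply]
  · rw [hπ, D.model_central, LinearMap.smul_apply, LinearMap.id_apply, map_smul,
      e.apply_symm_apply]
    rfl

end

end WeilCharTwo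

theorem theorem2p3
    {K : Type u} [Field K] [Algebra ℚ_[2] K] [FiniteDimensional ℚ_[2] K]
    [Algebra ℤ_[2] K] [IsScalarTower ℤ_[2] ℚ_[2] K]
    (hK : WeilCharTwo.IsUnramified K)
    {W : Type v} [AddCommGroup W] [Module (WeilCharTwo.ResidueRing K) W]
    [Module.Free (WeilCharTwo.ResidueRing K) W] [Module.Finite (WeilCharTwo.ResidueRing K) W]
    (ω : LinearMap.BilinForm (WeilCharTwo.ResidueRing K) W)
    (hω : WeilCharTwo.IsSymplectic ω)
    (S : WeilCharTwo.LagrangianSplitting ω) :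
    -- the Heisenberg representation exists
    (∃ (E : Type w) (_ : AddCommGroup E) (_ : Module ℂ E)
      (π : Representation ℂ (WeilCharTwo.Heisenberg (WeilCharTwo.cocycle S)) E),
      WeilCharTwo.IsHeisenbergRep (WeilCharTwo.psi K) π) ∧
    -- the affine metaplectic group, a central extension of `ASp(V)` by `μ₄`
    ∃ (AMp : Type (max u v)) (_ : Group AMp)
      (X : GroupExtension (rootsOfUnity 4 ℂ) AMp
        (WeilCharTwo.ASp (WeilCharTwo.cocycle S))),
      WeilCharTwo.IsCentralExtension X ∧
      ∀ (E : Type w) [AddCommGroup E] [Module ℂ E]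
        (π : Representation ℂ (WeilCharTwo.Heisenberg (WeilCharTwo.cocycle S)) E),
        WeilCharTwo.IsHeisenbergRep (WeilCharTwo.psi K) π →
        -- the projective Weil representation exists and is unique, and it lifts to `AMp(V)`
        ∃ σ : WeilCharTwo.ASp (WeilCharTwo.cocycle S) →* WeilCharTwo.PGL E,
          WeilCharTwo.IsProjectiveWeilRep π σ ∧
          (∀ σ' : WeilCharTwo.ASp (WeilCharTwo.cocycle S) →* WeilCharTwo.PGL E,
            WeilCharTwo.IsProjectiveWeilRep π σ' → σ' = σ) ∧
          ∃ ρ : AMp →* LinearMap.GeneralLinearGroup ℂ E,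
            ∀ a : AMp, (QuotientGroup.mk (ρ a) : WeilCharTwo.PGL E) = σ (X.rightHom a) := by
  have := WeilCharTwo.finite_reduction (K := K) (W := W)
  let D := WeilCharTwo.polarization hK hω S
  let : Fintype D.Q := Fintype.ofFinite _
  exact ⟨D.exists_isHeisenbergRep, D.AMp, inferInstance, D.extension,
    D.isCentralExtension_extension, fun _ _ _ _ hπ => D.exists_projectiveWeilRep hπ⟩
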